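/- Let $\mathfrak{s}$ and $\mathfrak{t}$ be nonnegative Hermitian forms on a complex vector space $\mathscr{D}$, i.e. sesquilinear maps $\mathscr{D}\times\mathscr{D}\to\mathbb{C}$ with $\mathfrak{s}(y,x)=\overline{\mathfrak{s}(x,y)}$ and $\mathfrak{s}(x,x)\ge 0$, and likewise for $\mathfrak{t}$. Let $\mathscr{H}_{\mathfrak{t}}$ be the Hilbert space completion of the quotient $\mathscr{D}/\mathscr{N}_{\mathfrak{t}}$, where $\mathscr{N}_{\mathfrak{t}}=\{x\in\mathscr{D}:\mathfrak{t}(x,x)=0\}$, with respect to the inner product $\langle x+\mathscr{N}_{\mathfrak{t}},\,y+\mathscr{N}_{\mathfrak{t}}\rangle_{\mathfrak{t}}=\mathfrak{t}(x,y)$; write $x$ also for the element $x+\mathscr{N}_{\mathfrak{t}}$ of $\mathscr{H}_{\mathfrak{t}}$. The following statements are equivalent: (i) $\mathfrak{s}$ is absolutely continuous with respect to $\mathfrak{t}$, that is, for every sequence $(x_n)_{n\in\mathbb{N}}$ in $\mathscr{D}$ with $\mathfrak{t}(x_n,x_n)\to 0$ as $n\to\infty$ and $\mathfrak{s}(x_n-x_m,x_n-x_m)\to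 0$ as $n,m\to\infty$, one has $\mathfrak{s}(x_n,x_n)\to 0$. (ii) There is a positive selfadjoint (not necessarily bounded) operator $S$ in $\mathscr{H}_{\mathfrak{t}}$, with positive selfadjoint square root $S^{1/2}$, such that $x\in\operatorname{dom}S^{1/2}$ for every $x\in\mathscr{D}$ and $$\langle S^{1/2}x,\,S^{1/2}y\rangle_{\mathfrak{t}}=\mathfrak{s}(x,y)\qquad\text{for all }x,y\in\mathscr{D}.$$ -/

import Mathlib

open Filter Topology UniformSpace
open scoped ComplexOrder

noncomputable section

namespace HermitianForm

/-! A nonnegative Hermitian form on a complex vector space `D` is a sesquilinear map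
`t : D →ₗ⋆[ℂ] D →ₗ[ℂ] ℂ` with `t.IsPosSemidef`, that is, `conj (t x y) = t y x` and `0 ≤ t x x`. -/

/-- The vector space `D`, regarded as a semi-inner product space through the form `t`. -/
def PreHilbert {D : Type*} [AddCommGroup D] [Module ℂ D] (t : D →ₗ⋆[ℂ] D →ₗ[ℂ] ℂ)
    (_ht : t.IsPosSemidef) : Type _ := D

section PreHilbert

variable {D : Type*} [AddCommGroup D] [Module ℂ D] (t : D →ₗ⋆[ℂ] D →ₗ[ℂ] ℂ)
  (ht : t.IsPosSemidef)

/-- The group structure of `D`. -/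
@[reducible]
def PreHilbert.addCommGroup : AddCommGroup (PreHilbert t ht) := inferInstanceAs (AddCommGroup D)

attribute [local instance] PreHilbert.addCommGroup

/-- The vector space structure of `D`. -/
@[reducible]
def PreHilbert.module : Module ℂ (PreHilbert t ht) := inferInstanceAs (Module ℂ D)

attribute [local instance] PreHilbert.module

/-- The semi-inner product `⟪x, y⟫ = t x y`. -/
@[reducible]
def PreHilbert.core : PreInnerProductSpace.Core ℂ (PreHilbert t ht) where
  inner x y := t x y
  conj_inner_symm x y := ht.isSymm.eq y x
  re_inner_nonneg x := (Complex.nonneg_iff.mp (ht.isNonneg.nonneg x)).1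
  add_left x y z := LinearMap.map_add₂ t x y z
  smul_left x y r := LinearMap.map_smulₛₗ₂ t r x y

instance PreHilbert.seminormedAddCommGroup : SeminormedAddCommGroup (PreHilbert t ht) :=
  @InnerProductSpace.Core.toSeminormedAddCommGroup ℂ (PreHilbert t ht) _ _ _ (PreHilbert.core t ht)

instance PreHilbert.innerProductSpace : InnerProductSpace ℂ (PreHilbert t ht) :=
  InnerProductSpace.ofCore (PreHilbert.core t ht)

end PreHilbert

/-- The Hilbert space `H_t`: the (Hausdorff) completion of `D` with respect to the semi-inner
product `t`, which is the completion of the pre-Hilbert space `D / N_t`, `N_t = {x | t x x = 0}`. -/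
abbrev HilbertSpace {D : Type*} [AddCommGroup D] [Module ℂ D] (t : D →ₗ⋆[ℂ] D →ₗ[ℂ] ℂ)
    (ht : t.IsPosSemidef) : Type _ := Completion (PreHilbert t ht)

/-- The canonical linear map `D → H_t`, `x ↦ x + N_t`. -/
def embed {D : Type*} [AddCommGroup D] [Module ℂ D] (t : D →ₗ⋆[ℂ] D →ₗ[ℂ] ℂ)
    (ht : t.IsPosSemidef) : D →ₗ[ℂ] HilbertSpace t ht where
  toFun x := ((show PreHilbert t ht from x : PreHilbert t ht) : Completion (PreHilbert t ht))
  map_add' x y := (Completion.toComplₗᵢ (𝕜 := ℂ) (E := PreHilbert t ht)).map_add x y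
  map_smul' c x := (Completion.toComplₗᵢ (𝕜 := ℂ) (E := PreHilbert t ht)).map_smul c x

theorem inner_embed {D : Type*} [AddCommGroup D] [Module ℂ D] (t : D →ₗ⋆[ℂ] D →ₗ[ℂ] ℂ)
    (ht : t.IsPosSemidef) (x y : D) : inner ℂ (embed t ht x) (embed t ht y) = t x y :=
  Completion.inner_coe (𝕜 := ℂ) (E := PreHilbert t ht) x y

theorem embed_eq_zero_iff {D : Type*} [AddCommGroup D] [Module ℂ D] (t : D →ₗ⋆[ℂ] D →ₗ[ℂ] ℂ)
    (ht : t.IsPosSemidef) (x : D) : embed t ht x = 0 ↔ t x x = 0 := by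
  rw [← inner_embed t ht, inner_self_eq_zero]

theorem denseRange_embed {D : Type*} [AddCommGroup D] [Module ℂ D] (t : D →ₗ⋆[ℂ] D →ₗ[ℂ] ℂ)
    (ht : t.IsPosSemidef) : DenseRange (embed t ht) :=
  Completion.denseRange_coe (α := PreHilbert t ht)

/-- `s` is absolutely continuous with respect to `t`: for every sequence `x` of `D`, if
`t(xₙ, xₙ) → 0` and `s(xₙ - xₘ, xₙ - xₘ) → 0` as `n, m → ∞`, then `s(xₙ, xₙ) → 0`. -/
def AbsolutelyContinuous {D : Type*} [AddCommGroup D] [Module ℂ D]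
    (s t : D →ₗ⋆[ℂ] D →ₗ[ℂ] ℂ) : Prop :=
  ∀ x : ℕ → D,
    Tendsto (fun n => t (x n) (x n)) atTop (𝓝 0) →
    Tendsto (fun p : ℕ × ℕ => s (x p.1 - x p.2) (x p.1 - x p.2)) atTop (𝓝 0) →
    Tendsto (fun n => s (x n) (x n)) atTop (𝓝 0)

/-- A positive selfadjoint (possibly unbounded) operator in a complex Hilbert space. In Mathlib a
selfadjoint `LinearPMap` is automatically densely defined. -/
structure IsPositiveSelfAdjoint {H : Type*} [NormedAddCommGroup H] [InnerProductSpace ℂ H]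
    [CompleteSpace H] (S : H →ₗ.[ℂ] H) : Prop where
  isSelfAdjoint : IsSelfAdjoint S
  nonneg : ∀ x : S.domain, 0 ≤ inner ℂ (S x) (x : H)

/-- `R = S^{1/2}`: `R` is the positive selfadjoint operator with `R ∘ R = S`, where `R ∘ R` has its
natural domain `{x ∈ dom R | R x ∈ dom R}`. (Each positive selfadjoint `S` has exactly one such
`R`.) -/
structure IsSquareRoot {H : Type*} [NormedAddCommGroup H] [InnerProductSpace ℂ H]
    [CompleteSpace H] (R S : H →ₗ.[ℂ] H) : Prop where
  isPositiveSelfAdjoint : IsPositiveSelfAdjoint R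
  comp_self : ∀ x y : H, (x, y) ∈ S.graph ↔ ∃ z : H, (x, z) ∈ R.graph ∧ (z, y) ∈ R.graph

end HermitianForm

end

/-!
A form `s` that is represented by a closed operator `R` in `H_t` is absolutely continuous with
respect to `t`: if `xₙ → 0` in `H_t` and `R xₙ` converges, closedness forces the limit to be `0`
(`absolutelyContinuous_of_isClosed`). A square root is selfadjoint, hence closed.

Conversely, absolute continuity says that the canonical contraction `A : H_{s+t} → H_t` extending
the identity of `D` is injective (`injective_embedExtension`). The operator `S` to be found
satisfies `(1 + S)⁻¹ = A A⋆`, so it can be built from the bounded operators `C = √(A A⋆)` and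
`E = √(1 - A A⋆)`, without any spectral theory of unbounded operators: `S^{1/2} = E C⁻¹` has the
graph `{(C u, E u)}` and `S = E² C⁻²` has the graph `{(C² u, E² u)}`. Both are selfadjoint, and the
first is the square root of the second, by elementary computations with the identity
`C² + E² = 1` (`isSelfAdjoint_quotientOperator`, `isSquareRoot_quotientOperator`).

The polar decomposition `A = C U` with a unitary `U : H_{s+t} → H_t`
(`exists_polar_of_contraction`) puts `D` into the range of `C`, which is the domain of `S^{1/2}`:
the image of `x` in `H_t` is `C u`, where `u` is the image under `U` of `x` in `H_{s+t}`. If `y`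
corresponds to `v` in the same way, then
`⟪S^{1/2} x, S^{1/2} y⟫ = ⟪E u, E v⟫ = ⟪u, v⟫ - ⟪C u, C v⟫ = (s + t)(x, y) - t(x, y) = s(x, y)`.
-/

namespace HermitianForm

/-! ### Unbounded operators given by a pair of bounded operators -/

section QuotientOperator

variable {H : Type*} [NormedAddCommGroup H] [InnerProductSpace ℂ H]

/-- The operator `P u ↦ Q u`, that is `Q P⁻¹` with domain `range P`, obtained from its graph
`{(P u, Q u)}`. If `P u = 0` with `Q u ≠ 0` for some `u`, the set is not a graph and the value of
the operator is junk; all uses have `P` injective. -/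
noncomputable def quotientOperator (P Q : H →L[ℂ] H) : H →ₗ.[ℂ] H :=
  (LinearMap.range (P.toLinearMap.prod Q.toLinearMap)).toLinearPMap

theorem mem_graph_quotientOperator {P Q : H →L[ℂ] H} (hP : Function.Injective P) (x y : H) :
    (x, y) ∈ (quotientOperator P Q).graph ↔ ∃ u, P u = x ∧ Q u = y := by
  have hg : ∀ p ∈ LinearMap.range (P.toLinearMap.prod Q.toLinearMap), p.1 = 0 → p.2 = 0 := by
    rintro _ ⟨u, rfl⟩ hu
    have : u = 0 := hP (by simpa using hu)
    simp [this]
  rw [quotientOperator, Submodule.toLinearPMap_graph_eq _ (fun p hp h => hg p hp h)]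
  simp [LinearMap.mem_range]

theorem apply_mem_domain_quotientOperator {P Q : H →L[ℂ] H} (hP : Function.Injective P) (u : H) :
    P u ∈ (quotientOperator P Q).domain :=
  LinearPMap.mem_domain_of_mem_graph ((mem_graph_quotientOperator hP _ (Q u)).2 ⟨u, rfl, rfl⟩)

theorem quotientOperator_apply {P Q : H →L[ℂ] H} (hP : Function.Injective P) (u : H)
    (hu : P u ∈ (quotientOperator P Q).domain) : quotientOperator P Q ⟨P u, hu⟩ = Q u :=
  ((LinearPMap.image_iff hu).2 ((mem_graph_quotientOperator hP _ _).2 ⟨u, rfl, rfl⟩)).symm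

theorem exists_of_mem_domain_quotientOperator {P Q : H →L[ℂ] H} (hP : Function.Injective P)
    (x : (quotientOperator P Q).domain) : ∃ u, P u = x ∧ Q u = quotientOperator P Q x :=
  (mem_graph_quotientOperator hP _ _).1 (LinearPMap.mem_graph _ x)

variable [CompleteSpace H]

/-- An injective selfadjoint bounded operator has dense range. -/
theorem denseRange_of_isSelfAdjoint {P : H →L[ℂ] H} (hP : Function.Injective P)
    (hPs : IsSelfAdjoint P) : DenseRange P := by
  have h := ContinuousLinearMap.orthogonal_range P
  rw [ContinuousLinearMap.isSelfAdjoint_iff'.1 hPs, LinearMap.ker_eq_bot.2 hP,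
    ← Submodule.topologicalClosure_eq_top_iff] at h
  exact Submodule.dense_iff_topologicalClosure_eq_top.2 h

/-- If `X` and `Y` solve the Bézout identity `P X + Q Y = 1`, then `Q P⁻¹` is selfadjoint: its
adjoint consists of the pairs `(a, b)` with `P b = Q a`, and such a pair is `(P w, Q w)` for
`w = X a + Y b`. -/
theorem isSelfAdjoint_quotientOperator {P Q X Y : H →L[ℂ] H} (hP : Function.Injective P)
    (hPs : IsSelfAdjoint P) (hQs : IsSelfAdjoint Q) (hPQ : Commute P Q) (hPX : Commute P X)
    (hPY : Commute P Y) (hQX : Commute Q X) (hQY : Commute Q Y) (h1 : P * X + Q * Y = 1) :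
    IsSelfAdjoint (quotientOperator P Q) := by
  have hd : Dense ((quotientOperator P Q).domain : Set H) :=
    (denseRange_of_isSelfAdjoint hP hPs).mono
      (Set.range_subset_iff.2 (apply_mem_domain_quotientOperator hP))
  have hPi : ∀ x y, inner ℂ (P x) y = inner ℂ x (P y) := hPs.isSymmetric
  have hQi : ∀ x y, inner ℂ (Q x) y = inner ℂ x (Q y) := hQs.isSymmetric
  have app : ∀ {F G : H →L[ℂ] H}, Commute F G → ∀ v, F (G v) = G (F v) := fun h v =>
    congrArg (fun T : H →L[ℂ] H => T v) h.eq
  have h1v : ∀ v, P (X v) + Q (Y v) = v := fun v =>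
    congrArg (fun T : H →L[ℂ] H => T v) h1
  rw [LinearPMap.isSelfAdjoint_def]
  refine LinearPMap.eq_of_eq_graph ?_
  ext ⟨a, b⟩
  rw [LinearPMap.adjoint_graph_eq_graph_adjoint hd, Submodule.mem_adjoint_iff,
    mem_graph_quotientOperator hP]
  simp only [mem_graph_quotientOperator hP]
  constructor
  · intro h
    have hab : P b = Q a := by
      refine (ext_inner_left ℂ fun u => ?_).symm
      rw [← hPi, ← hQi]
      exact sub_eq_zero.1 (h _ _ ⟨u, rfl, rfl⟩)
    refine ⟨X a + Y b, ?_, ?_⟩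
    · rw [map_add, app hPY, hab, ← app hQY, h1v]
    · rw [map_add, app hQX, ← hab, ← app hPX, h1v]
  · rintro ⟨w, rfl, rfl⟩ _ _ ⟨u, rfl, rfl⟩
    rw [hPi, hQi, app hPQ, sub_self]

/-- For bounded positive commuting `C` and `E` with `C² + E² = 1` and `C` injective, the operators
`E C⁻¹` and `E² C⁻²` are positive and selfadjoint, and the first is the square root of the
second. -/
theorem isSquareRoot_quotientOperator {C E : H →L[ℂ] H} (hC : Function.Injective C)
    (hC0 : 0 ≤ C) (hE0 : 0 ≤ E) (hCE : Commute C E) (h1 : C * C + E * E = 1) :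
    IsPositiveSelfAdjoint (quotientOperator (C * C) (E * E)) ∧
      IsSquareRoot (quotientOperator C E) (quotientOperator (C * C) (E * E)) := by
  have hCs : IsSelfAdjoint C := IsSelfAdjoint.of_nonneg hC0
  have hEs : IsSelfAdjoint E := IsSelfAdjoint.of_nonneg hE0
  have hCi : ∀ x y, inner ℂ (C x) y = inner ℂ x (C y) := hCs.isSymmetric
  have hEi : ∀ x y, inner ℂ (E x) y = inner ℂ x (E y) := hEs.isSymmetric
  have app : ∀ v, C (E v) = E (C v) := fun v => congrArg (fun T : H →L[ℂ] H => T v) hCE.eq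
  have h1v : ∀ v, C (C v) + E (E v) = v := fun v => congrArg (fun T : H →L[ℂ] H => T v) h1
  have hCC : Function.Injective (C * C) := hC.comp hC
  have hCC' : Commute C (E * E) := hCE.mul_right hCE
  refine ⟨⟨?_, ?_⟩, ⟨?_, ?_⟩, ?_⟩
  · refine isSelfAdjoint_quotientOperator (X := 1) (Y := 1) hCC ?_ ?_ (hCC'.mul_left hCC')
      (.one_right _) (.one_right _) (.one_right _) (.one_right _) (by simpa using h1)
    · exact hCs.commute_iff hCs |>.1 rfl
    · exact hEs.commute_iff hEs |>.1 rfl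
  · intro x
    obtain ⟨u, hu, hv⟩ := exists_of_mem_domain_quotientOperator hCC x
    rw [← hu, ← hv]
    change 0 ≤ inner ℂ (E (E u)) (C (C u))
    rw [hEi, ← app, ← hCi, app, inner_self_eq_norm_sq_to_K]
    exact pow_nonneg (Complex.zero_le_real.2 (norm_nonneg (E (C u)))) 2
  · exact isSelfAdjoint_quotientOperator (X := C) (Y := E) hC hCs hEs hCE (.refl _) hCE
      hCE.symm (.refl _) h1
  · intro x
    obtain ⟨u, hu, hv⟩ := exists_of_mem_domain_quotientOperator hC x
    rw [← hu, ← hv, ← hCi]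
    have hpos := (ContinuousLinearMap.nonneg_iff_isPositive _).1 (hCE.mul_nonneg hC0 hE0)
    exact hpos.inner_nonneg_left u
  · intro x y
    simp only [mem_graph_quotientOperator hC, mem_graph_quotientOperator hCC]
    constructor
    · rintro ⟨w, rfl, rfl⟩
      exact ⟨E (C w), ⟨C w, rfl, rfl⟩, E w, app w, rfl⟩
    · rintro ⟨_, ⟨u, rfl, rfl⟩, v, hv, rfl⟩
      -- `C u` and `E v` with `C v = E u`: the common preimage is `C u + E v`
      refine ⟨C u + E v, ?_, ?_⟩
      · change C (C (C u + E v)) = C u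
        rw [map_add, app, hv, h1v]
      · change E (E (C u + E v)) = E v
        rw [map_add, ← app, ← hv, h1v]

end QuotientOperator

/-! ### Polar decomposition of an injective contraction -/

section Polar

variable {H K : Type*} [NormedAddCommGroup H] [InnerProductSpace ℂ H] [CompleteSpace H]
  [NormedAddCommGroup K] [InnerProductSpace ℂ K] [CompleteSpace K]

/-- With `B = A A⋆`, take `C = √B` and `E = √(1 - B)`. As `‖C h‖ = ‖A⋆ h‖`, the map `C h ↦ A⋆ h`
extends to a unitary `V : H → K`, and `A = C U` for `U = V⁻¹`. -/
theorem exists_polar_of_contraction (A : K →L[ℂ] H) (hA : Function.Injective A)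
    (hd : DenseRange A) (hA1 : ∀ k, ‖A k‖ ≤ ‖k‖) :
    ∃ (C E : H →L[ℂ] H) (U : K ≃ₗᵢ[ℂ] H), Function.Injective C ∧ 0 ≤ C ∧ 0 ≤ E ∧ Commute C E ∧
      C * C + E * E = 1 ∧ ∀ k, C (U k) = A k := by
  set T := ContinuousLinearMap.adjoint A with hT
  set B : H →L[ℂ] H := A ∘L T with hB
  have hAn : ‖A‖ ≤ 1 := A.opNorm_le_bound zero_le_one (by simpa using hA1)
  have hT1 : ∀ h, ‖T h‖ ≤ ‖h‖ := fun h => by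
    have := T.le_of_opNorm_le (c := 1) (by rw [hT, LinearIsometryEquiv.norm_map]; exact hAn) h
    simpa using this
  have hBi : ∀ x y, inner ℂ (B x) y = inner ℂ (T x) (T y) := fun x y => by
    rw [hT, ContinuousLinearMap.adjoint_inner_right]; rfl
  have hB0 : 0 ≤ B := by
    rw [ContinuousLinearMap.nonneg_iff_isPositive]
    exact ContinuousLinearMap.isPositive_self_comp_adjoint A
  have hB1 : 0 ≤ 1 - B := by
    rw [ContinuousLinearMap.nonneg_iff_isPositive, ContinuousLinearMap.isPositive_iff_complex]
    intro x
    have h1 : inner ℂ ((1 - B) x) x = ((‖x‖ ^ 2 - ‖T x‖ ^ 2 : ℝ) : ℂ) := by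
      rw [sub_apply, inner_sub_left, hBi, inner_self_eq_norm_sq_to_K,
        one_apply_eq_self, inner_self_eq_norm_sq_to_K]
      simp
    rw [h1]
    refine ⟨congrArg _ (Complex.ofReal_re _), ?_⟩
    have := pow_le_pow_left₀ (norm_nonneg _) (hT1 x) 2
    simpa only [RCLike.re_eq_complex_re, Complex.ofReal_re, sub_nonneg] using this
  set C := CFC.sqrt B with hCdef
  set E := CFC.sqrt (1 - B) with hEdef
  have hC0 : 0 ≤ C := CFC.sqrt_nonneg _
  have hE0 : 0 ≤ E := CFC.sqrt_nonneg _
  have hCC : C * C = B := CFC.sqrt_mul_sqrt_self B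
  have hEE : E * E = 1 - B := CFC.sqrt_mul_sqrt_self (1 - B)
  have hCB : Commute C (1 - B) := by
    rw [← hCC]
    exact (Commute.one_right C).sub_right ((Commute.refl C).mul_right (Commute.refl C))
  have hCE : Commute C E := (hCB.symm.cfcₙ_nnreal _).symm
  have hCs : IsSelfAdjoint C := IsSelfAdjoint.of_nonneg hC0
  have hCi : ∀ x y, inner ℂ (C x) y = inner ℂ x (C y) := hCs.isSymmetric
  have hnorm : ∀ h, ‖T h‖ = ‖C h‖ := fun h => by
    have h1 : inner ℂ (T h) (T h) = inner ℂ (C h) (C h) := by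
      rw [← hBi, ← hCi, ← hCC]; rfl
    rw [@norm_eq_sqrt_re_inner ℂ, @norm_eq_sqrt_re_inner ℂ, h1]
  have hTinj : Function.Injective T := by
    rw [← ContinuousLinearMap.coe_coe, ← LinearMap.ker_eq_bot, hT,
      ← ContinuousLinearMap.orthogonal_range, ← Submodule.topologicalClosure_eq_top_iff]
    exact Submodule.dense_iff_topologicalClosure_eq_top.1 hd
  have hTd : DenseRange T := by
    have h := ContinuousLinearMap.orthogonal_range T
    rw [hT, ContinuousLinearMap.adjoint_adjoint, LinearMap.ker_eq_bot.2 hA,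
      ← Submodule.topologicalClosure_eq_top_iff] at h
    exact Submodule.dense_iff_topologicalClosure_eq_top.2 h
  have hCinj : Function.Injective C := by
    refine (injective_iff_map_eq_zero C).2 fun h hh => hTinj ?_
    rw [map_zero, ← norm_eq_zero, hnorm, hh, norm_zero]
  have hCd : DenseRange C := denseRange_of_isSelfAdjoint hCinj hCs
  let V : H ≃ₗᵢ[ℂ] K :=
    (LinearEquiv.refl ℂ H).extendOfIsometry C.toLinearMap T.toLinearMap hCd hTd hnorm
  have hV : ∀ h, V (C h) = T h := fun h =>
    LinearEquiv.extendOfIsometry_eq (LinearEquiv.refl ℂ H) C.toLinearMap T.toLinearMap hCd hTd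
      hnorm h
  refine ⟨C, E, V.symm, hCinj, hC0, hE0, hCE, by rw [hCC, hEE]; abel, fun k => ?_⟩
  refine ext_inner_left ℂ fun h => ?_
  rw [← hCi, ← V.inner_map_map, hV, V.apply_symm_apply, hT,
    ContinuousLinearMap.adjoint_inner_left]

end Polar

/-! ### Absolute continuity and closability -/

section Forms

variable {D : Type*} [AddCommGroup D] [Module ℂ D] {s t : D →ₗ⋆[ℂ] D →ₗ[ℂ] ℂ}

variable {H : Type*} [NormedAddCommGroup H] [InnerProductSpace ℂ H]

/-- Here and below, `F` represents the form `s` in a Hilbert space: `⟪F x, F y⟫ = s x y`. It is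
applied to `embed s` and to `x ↦ R x`. -/
theorem form_self_eq_norm_sq {F : D →ₗ[ℂ] H} (hF : ∀ x y, inner ℂ (F x) (F y) = s x y) (x : D) :
    s x x = ((‖F x‖ ^ 2 : ℝ) : ℂ) := by
  rw [← hF, inner_self_eq_norm_sq_to_K]
  simp

theorem tendsto_form_self_iff {F : D →ₗ[ℂ] H} (hF : ∀ x y, inner ℂ (F x) (F y) = s x y)
    {ι : Type*} {l : Filter ι} (x : ι → D) :
    Tendsto (fun n => s (x n) (x n)) l (𝓝 0) ↔ Tendsto (fun n => F (x n)) l (𝓝 0) := by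
  simp only [form_self_eq_norm_sq hF]
  rw [tendsto_zero_iff_norm_tendsto_zero (f := fun n => F (x n)),
    tendsto_zero_iff_norm_tendsto_zero]
  simp only [Complex.norm_real, norm_pow, norm_norm]
  refine ⟨fun h => ?_, fun h => by simpa using h.pow 2⟩
  simpa [Real.sqrt_sq (norm_nonneg _)] using h.sqrt

theorem tendsto_form_sub_iff_cauchySeq {F : D →ₗ[ℂ] H}
    (hF : ∀ x y, inner ℂ (F x) (F y) = s x y) (x : ℕ → D) :
    Tendsto (fun p : ℕ × ℕ => s (x p.1 - x p.2) (x p.1 - x p.2)) atTop (𝓝 0) ↔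
      CauchySeq fun n => F (x n) := by
  rw [tendsto_form_self_iff hF (fun p : ℕ × ℕ => x p.1 - x p.2), cauchySeq_iff_tendsto,
    uniformity_eq_comap_nhds_zero_swapped, tendsto_comap_iff]
  simp only [map_sub]
  rfl

/-- A form represented by a closed operator `R` in `H_t` is absolutely continuous: if
`t(xₙ, xₙ) → 0` and `R xₙ` converges to `z`, then `(0, z)` lies in the graph of `R`. -/
theorem absolutelyContinuous_of_isClosed (ht : t.IsPosSemidef)
    {R : HilbertSpace t ht →ₗ.[ℂ] HilbertSpace t ht} (hR : R.IsClosed)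
    (hD : ∀ x : D, embed t ht x ∈ R.domain)
    (h : ∀ x y : D, inner ℂ (R ⟨embed t ht x, hD x⟩) (R ⟨embed t ht y, hD y⟩) = s x y) :
    AbsolutelyContinuous s t := by
  intro x hx hc
  let F : D →ₗ[ℂ] HilbertSpace t ht := R.toFun ∘ₗ (embed t ht).codRestrict R.domain hD
  have hF : ∀ x y, inner ℂ (F x) (F y) = s x y := h
  rw [tendsto_form_self_iff (inner_embed t ht)] at hx
  rw [tendsto_form_sub_iff_cauchySeq hF] at hc
  rw [tendsto_form_self_iff hF]
  obtain ⟨z, hz⟩ := cauchySeq_tendsto_of_complete hc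
  have hmem : ((0 : HilbertSpace t ht), z) ∈ R.graph :=
    IsClosed.mem_of_tendsto hR (hx.prodMk_nhds hz)
      (Eventually.of_forall fun n => R.mem_graph ⟨embed t ht (x n), hD (x n)⟩)
  rwa [R.graph_fst_eq_zero_snd hmem rfl] at hz

theorem norm_embed_add_sq (hs : s.IsPosSemidef) (ht : t.IsPosSemidef)
    (hst : (s + t).IsPosSemidef) (x : D) :
    ‖embed (s + t) hst x‖ ^ 2 = ‖embed s hs x‖ ^ 2 + ‖embed t ht x‖ ^ 2 := by
  have h : (s + t) x x = s x x + t x x := rfl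
  rw [form_self_eq_norm_sq (inner_embed _ hst), form_self_eq_norm_sq (inner_embed s hs),
    form_self_eq_norm_sq (inner_embed t ht)] at h
  exact_mod_cast h

theorem norm_embed_left_le (hs : s.IsPosSemidef) (ht : t.IsPosSemidef)
    (hst : (s + t).IsPosSemidef) (x : D) : ‖embed s hs x‖ ≤ ‖embed (s + t) hst x‖ := by
  refine le_of_sq_le_sq ?_ (norm_nonneg _)
  rw [norm_embed_add_sq hs ht]
  exact le_add_of_nonneg_right (sq_nonneg _)

theorem norm_embed_right_le (hs : s.IsPosSemidef) (ht : t.IsPosSemidef)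
    (hst : (s + t).IsPosSemidef) (x : D) : ‖embed t ht x‖ ≤ ‖embed (s + t) hst x‖ := by
  refine le_of_sq_le_sq ?_ (norm_nonneg _)
  rw [norm_embed_add_sq hs ht]
  exact le_add_of_nonneg_left (sq_nonneg _)

/-- The contraction `H_{s+t} → H_t` that extends the identity of `D`. -/
noncomputable def embedExtension (hst : (s + t).IsPosSemidef) (ht : t.IsPosSemidef) :
    HilbertSpace (s + t) hst →L[ℂ] HilbertSpace t ht :=
  (embed t ht).extendOfNorm (embed (s + t) hst)

theorem embedExtension_embed (hs : s.IsPosSemidef) (ht : t.IsPosSemidef)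
    (hst : (s + t).IsPosSemidef) (x : D) :
    embedExtension hst ht (embed (s + t) hst x) = embed t ht x :=
  LinearMap.extendOfNorm_eq (denseRange_embed _ hst)
    ⟨1, fun x => by simpa using norm_embed_right_le hs ht hst x⟩ x

theorem norm_embedExtension_le (hs : s.IsPosSemidef) (ht : t.IsPosSemidef)
    (hst : (s + t).IsPosSemidef) (k : HilbertSpace (s + t) hst) :
    ‖embedExtension hst ht k‖ ≤ ‖k‖ := by
  simpa [embedExtension] using
    LinearMap.norm_extendOfNorm_apply_le (f := embed t ht) (denseRange_embed _ hst) 1 (fun x => by simpa using norm_embed_right_le hs ht hst x) k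

/-- Absolute continuity says that the identity of `D`, seen as a map from `H_t` to `H_s`, is
closable, and this makes the canonical map `H_{s+t} → H_t` injective. -/
theorem injective_embedExtension (hs : s.IsPosSemidef) (ht : t.IsPosSemidef)
    (hst : (s + t).IsPosSemidef) (hac : AbsolutelyContinuous s t) :
    Function.Injective (embedExtension hst ht) := by
  refine (injective_iff_map_eq_zero _).2 fun k hk => ?_
  obtain ⟨y, hy, hyk⟩ := mem_closure_iff_seq_limit.1 (denseRange_embed (s + t) hst k)
  choose x hx using hy
  obtain rfl : (fun n => embed (s + t) hst (x n)) = y := funext hx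
  have h_t : Tendsto (fun n => t (x n) (x n)) atTop (𝓝 0) := by
    rw [tendsto_form_self_iff (inner_embed t ht)]
    have := ((embedExtension hst ht).continuous.tendsto k).comp hyk
    simpa only [Function.comp_def, embedExtension_embed hs, hk] using this
  have h_c : Tendsto (fun p : ℕ × ℕ => s (x p.1 - x p.2) (x p.1 - x p.2)) atTop (𝓝 0) := by
    have hc := (tendsto_form_sub_iff_cauchySeq (inner_embed (s + t) hst) x).2 hyk.cauchySeq
    rw [tendsto_form_self_iff (inner_embed _ hst) fun p : ℕ × ℕ => x p.1 - x p.2] at hc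
    rw [tendsto_form_self_iff (inner_embed s hs) fun p : ℕ × ℕ => x p.1 - x p.2]
    exact squeeze_zero_norm (fun p => norm_embed_left_le hs ht hst _)
      (tendsto_zero_iff_norm_tendsto_zero.1 hc)
  have h_st : Tendsto (fun n => (s + t) (x n) (x n)) atTop (𝓝 0) := by
    simpa using (hac x h_t h_c).add h_t
  rw [tendsto_form_self_iff (inner_embed (s + t) hst)] at h_st
  exact tendsto_nhds_unique hyk h_st

end Forms

end HermitianForm

theorem mainTheorem2 {D : Type*} [AddCommGroup D] [Module ℂ D]
    (s t : D →ₗ⋆[ℂ] D →ₗ[ℂ] ℂ) (_hs : s.IsPosSemidef) (ht : t.IsPosSemidef) :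
    HermitianForm.AbsolutelyContinuous s t ↔
      ∃ S : HermitianForm.HilbertSpace t ht →ₗ.[ℂ] HermitianForm.HilbertSpace t ht,
        HermitianForm.IsPositiveSelfAdjoint S ∧
        ∃ R : HermitianForm.HilbertSpace t ht →ₗ.[ℂ] HermitianForm.HilbertSpace t ht,
          HermitianForm.IsSquareRoot R S ∧
          ∃ hD : ∀ x : D, HermitianForm.embed t ht x ∈ R.domain,
            ∀ x y : D,
              inner ℂ (R ⟨HermitianForm.embed t ht x, hD x⟩)
                (R ⟨HermitianForm.embed t ht y, hD y⟩) = s x y := by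
  constructor
  · intro hac
    have hst := _hs.add ht
    obtain ⟨C, E, U, hC, hC0, hE0, hCE, h1, hU⟩ := HermitianForm.exists_polar_of_contraction
      (HermitianForm.embedExtension hst ht)
      (HermitianForm.injective_embedExtension _hs ht hst hac)
      ((HermitianForm.denseRange_embed t ht).mono (Set.range_subset_iff.2 fun x =>
        ⟨_, HermitianForm.embedExtension_embed _hs ht hst x⟩))
      (HermitianForm.norm_embedExtension_le _hs ht hst)
    obtain ⟨hS, hR⟩ := HermitianForm.isSquareRoot_quotientOperator hC hC0 hE0 hCE h1
    have hCu : ∀ x, C (U (HermitianForm.embed (s + t) hst x)) = HermitianForm.embed t ht x :=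
      fun x => (hU _).trans (HermitianForm.embedExtension_embed _hs ht hst x)
    have hD : ∀ x, HermitianForm.embed t ht x ∈ (HermitianForm.quotientOperator C E).domain :=
      fun x => hCu x ▸ HermitianForm.apply_mem_domain_quotientOperator hC _
    refine ⟨_, hS, _, hR, hD, fun x y => ?_⟩
    have hRx : ∀ x, HermitianForm.quotientOperator C E ⟨HermitianForm.embed t ht x, hD x⟩ =
        E (U (HermitianForm.embed (s + t) hst x)) := fun x => by
      simp only [← hCu x]
      exact HermitianForm.quotientOperator_apply hC _ _
    have hCi := (IsSelfAdjoint.of_nonneg hC0).isSymmetric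
    have hEi := (IsSelfAdjoint.of_nonneg hE0).isSymmetric
    rw [hRx, hRx]
    -- `⟪E u, E v⟫ = ⟪u, v⟫ - ⟪C u, C v⟫`, where `⟪u, v⟫ = s x y + t x y` and `⟪C u, C v⟫ = t x y`
    have key : ∀ u v, inner ℂ (C u) (C v) + inner ℂ (E u) (E v) = inner ℂ u v := fun u v => by
      have e1 : inner ℂ (C u) (C v) = inner ℂ u (C (C v)) := hCi u (C v)
      have e2 : inner ℂ (E u) (E v) = inner ℂ u (E (E v)) := hEi u (E v)
      rw [e1, e2, ← inner_add_right]
      exact congrArg (fun T => inner ℂ u (T v)) h1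
    have h := key (U (HermitianForm.embed (s + t) hst x)) (U (HermitianForm.embed (s + t) hst y))
    rw [hCu, hCu, U.inner_map_map, HermitianForm.inner_embed, HermitianForm.inner_embed,
      LinearMap.add_apply, LinearMap.add_apply, add_comm] at h
    exact add_right_cancel h
  · rintro ⟨S, -, R, hR, hD, h⟩
    exact HermitianForm.absolutelyContinuous_of_isClosed ht
      hR.isPositiveSelfAdjoint.isSelfAdjoint.isClosed hD h
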